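/- Let $K$ be a field, let $n\in\mathbb N$ and $P=K[X_0,\dots,X_n]$, and let $\mathbb X\subseteq\mathbb P^n_K$ be a non-empty reduced $0$-dimensional closed subscheme with homogeneous (saturated) vanishing ideal $I_{\mathbb X}\subseteq P$ such that no closed point of $\mathbb X$ lies on the hyperplane $\mathcal Z(X_0)$. Put $R=P/I_{\mathbb X}$, let $x_0\in R$ be the image of $X_0$, and let $\deg(\mathbb X)=\dim_K R/\langle x_0-1\rangle$. Assume that $\operatorname{char}(K)=0$ or $\operatorname{char}(K)>\deg(\mathbb X)$. Write $\operatorname{HF}_M(i)=\dim_K M_i$ $(i\in\mathbb Z)$ for the Hilbert function of a finitely generated graded $R$-module $M$, and $\operatorname{HF}_{\mathbb X}=\operatorname{HF}_R$. The scheme $\mathbb X$ is said to be in generic position if $\operatorname{HF}_{\mathbb X}(i)=\min\{\deg(\mathbb X),\binom{n+i}{n}\}$ for all $i\in\mathbb Z$, where $\binom{n+i}{n}$ is read as $\dim_K P_i$, i.e. as $0$ for $i<0$. Let $\vartheta_{\mathbb X}=F_0(\Omega^1_{R/K[x_0]})$ be the Kähler different of $\mathbb X$, that is, the initial Fitting ideal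 of the module of Kähler differentials of the algebra $R/K[x_0]$; it is a homogeneous ideal of $R$. Suppose that $\binom{n+(\alpha-1)}{n}<\deg(\mathbb X)<\binom{n+\alpha}{n}$ for some integer $\alpha>1$, and that the following conditions are satisfied: (i) $\operatorname{HF}_{\mathbb X}(\alpha)=\deg(\mathbb X)$; (ii) $\dim_K (I_{\mathbb X})_\alpha\ge n$; (iii) there are a field extension $K\subseteq L$ and $n$ $K$-linearly independent forms $F_1,\dots,F_n\in(I_{\mathbb X})_\alpha$ which meet in precisely $\alpha^n$ distinct $L$-rational points of $\mathbb P^n_L$, i.e. the common zero locus of $F_1,\dots,F_n$ in $\mathbb P^n_L$ consists of exactly $\alpha^n$ points, all of which are $L$-rational. Then $\mathbb X$ is in generic position if and only if $\operatorname{HF}_{\vartheta_{\mathbb X}}(n\alpha-n-1)=0$. -/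

import Mathlib

open MvPolynomial

attribute [local instance] MvPolynomial.gradedAlgebra

universe u v

noncomputable section

/-- The initial (zeroth) Fitting ideal `F₀(M)` of a finitely generated `R`-module `M`: the ideal
generated by the determinants of the square matrices whose rows are relations of a finite
generating family `m₁, …, m_k` of `M`.  The ideal obtained from one generating family does not
depend on the family, so that all of them may be used at once. -/
def initialFittingIdeal (R : Type u) [CommRing R] (M : Type v) [AddCommGroup M] [Module R M] :
    Ideal R :=
  Ideal.span {d | ∃ (k : ℕ) (m : Fin k → M) (A : Matrix (Fin k) (Fin k) R),
    Submodule.span R (Set.range m) = ⊤ ∧ (∀ i, ∑ j, A i j • m j = 0) ∧ d = A.det}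

/-- A non-empty `0`-dimensional closed subscheme `𝕏` of the projective space `ℙⁿ_K` none of whose
points lies on the hyperplane `𝒵(X₀)`, given by its homogeneous vanishing ideal `I_𝕏` in
`P = K[X₀, …, Xₙ]`.  Closed subschemes of `ℙⁿ_K` correspond bijectively to the homogeneous
ideals of `P` that are saturated with respect to `(X₀, …, Xₙ)`. -/
structure ZeroDimSubscheme (K : Type u) [Field K] (n : ℕ) where
  /-- the homogeneous vanishing ideal `I_𝕏` -/
  ideal : Ideal (MvPolynomial (Fin (n + 1)) K)
  isHomogeneous : ideal.IsHomogeneous (homogeneousSubmodule (Fin (n + 1)) K)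
  saturated : ∀ f : MvPolynomial (Fin (n + 1)) K, (∀ i, X i * f ∈ ideal) → f ∈ ideal
  /-- the support is `0`-dimensional (in particular non-empty: `∅` has dimension `⊥`) -/
  dim_eq_zero : topologicalKrullDim
    (ProjectiveSpectrum.zeroLocus (homogeneousSubmodule (Fin (n + 1)) K)
      (ideal : Set (MvPolynomial (Fin (n + 1)) K))) = 0
  /-- `Supp(𝕏) ∩ 𝒵(X₀) = ∅` -/
  support_inter : ProjectiveSpectrum.zeroLocus (homogeneousSubmodule (Fin (n + 1)) K)
      (ideal : Set (MvPolynomial (Fin (n + 1)) K)) ∩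
    ProjectiveSpectrum.zeroLocus (homogeneousSubmodule (Fin (n + 1)) K) {X 0} = ∅

namespace ZeroDimSubscheme

variable {K : Type u} [Field K] {n : ℕ} (𝕏 : ZeroDimSubscheme K n)

/-- The homogeneous coordinate ring `R = P / I_𝕏`. -/
abbrev coordRing : Type u := MvPolynomial (Fin (n + 1)) K ⧸ 𝕏.ideal

/-- The image `x₀` of `X₀` in `R`. -/
def x₀ : 𝕏.coordRing := Ideal.Quotient.mk 𝕏.ideal (X 0)

/-- The subalgebra `K[x₀]` of `R`. -/
abbrev baseRing : Subalgebra K 𝕏.coordRing := Algebra.adjoin K {𝕏.x₀}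

/-- `𝕏` is reduced as a scheme: its saturated ideal `I_𝕏` is a radical ideal. -/
def Reduced : Prop := 𝕏.ideal.IsRadical

/-- `deg(𝕏) = dim_K S`, where `S = R / (x₀ - 1)` is the coordinate ring of the (`0`-dimensional,
affine) scheme `𝕏` in the affine space `D₊(X₀)`, which contains `𝕏`. -/
def deg : ℕ :=
  Module.finrank K (MvPolynomial (Fin (n + 1)) K ⧸ (𝕏.ideal ⊔ Ideal.span {X 0 - 1}))

/-- The homogeneous component `(I_𝕏)_d` of the vanishing ideal. -/
def idealPart (d : ℕ) : Submodule K (MvPolynomial (Fin (n + 1)) K) :=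
  𝕏.ideal.restrictScalars K ⊓ homogeneousSubmodule (Fin (n + 1)) K d

/-- The homogeneous component `R_d` of the coordinate ring, the image of `P_d`. -/
def gradedPart (d : ℕ) : Submodule K 𝕏.coordRing :=
  (homogeneousSubmodule (Fin (n + 1)) K d).map (Ideal.Quotient.mkₐ K 𝕏.ideal).toLinearMap

/-- The Hilbert function `i ↦ dim_K J_i`, `i ∈ ℤ`, of a homogeneous ideal `J` of `R`, where
`J_i = J ∩ R_i` (and `R_i = 0` for `i < 0`). -/
def hilbertFunction (J : Ideal 𝕏.coordRing) (i : ℤ) : ℕ :=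
  if 0 ≤ i then
    Module.finrank K ↥(J.restrictScalars K ⊓ 𝕏.gradedPart i.toNat)
  else 0

/-- The Hilbert function `HF_𝕏 = HF_R` of `𝕏`. -/
def HF (i : ℤ) : ℕ := 𝕏.hilbertFunction ⊤ i

/-- `𝕏` is in generic position: `HF_𝕏(i) = min {deg(𝕏), binom(n + i, n)}` for all `i ∈ ℤ`, where
the binomial coefficient, being `dim_K P_i`, is `0` for `i < 0`. -/
def InGenericPosition : Prop :=
  ∀ i : ℤ, 𝕏.HF i = min 𝕏.deg (if 0 ≤ i then (n + i.toNat).choose n else 0)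

/-- The Kähler different `ϑ_𝕏 = F₀(Ω¹_{R/K[x₀]})` of `𝕏`. -/
def kaehlerDifferent : Ideal 𝕏.coordRing :=
  initialFittingIdeal 𝕏.coordRing (KaehlerDifferential 𝕏.baseRing 𝕏.coordRing)

end ZeroDimSubscheme

/-- A point of `ℙⁿ_L = Proj L[X₀, …, Xₙ]` is `L`-rational if it is the point `(v₀ : … : vₙ)` for
some non-zero `v` in `L^{n+1}`, that is, if the forms in its homogeneous prime ideal are those
that vanish at `v`. -/
def IsRationalPoint {L : Type v} [Field L] {n : ℕ}
    (x : ProjectiveSpectrum (homogeneousSubmodule (Fin (n + 1)) L)) : Prop :=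
  ∃ w : Fin (n + 1) → L, w ≠ 0 ∧
    ∀ (d : ℕ), ∀ f ∈ homogeneousSubmodule (Fin (n + 1)) L d,
      (f ∈ x.asHomogeneousIdeal ↔ eval w f = 0)

/-- The common zeros in `ℙⁿ_L` (all scheme-theoretic points, closed or not) of a family of
forms over `K`, for a field extension `K ⊆ L`. -/
def commonZeros {K : Type u} [Field K] (L : Type v) [Field L] [Algebra K L] {n : ℕ} {ι : Type}
    (F : ι → MvPolynomial (Fin (n + 1)) K) :
    Set (ProjectiveSpectrum (homogeneousSubmodule (Fin (n + 1)) L)) :=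
  ProjectiveSpectrum.zeroLocus (homogeneousSubmodule (Fin (n + 1)) L)
    (Set.range fun j => MvPolynomial.map (algebraMap K L) (F j))

/-- The forms `F` meet in precisely `N` distinct points of `ℙⁿ_L`, all of them `L`-rational. -/
def MeetInRationalPoints {K : Type u} [Field K] (L : Type v) [Field L] [Algebra K L] {n : ℕ}
    {ι : Type} (F : ι → MvPolynomial (Fin (n + 1)) K) (N : ℕ) : Prop :=
  (commonZeros L F).encard = N ∧ ∀ x ∈ commonZeros L F, IsRationalPoint x

end

/-! Since `HF α = deg`, generic position means that `I_𝕏` has no non-zero form of degree below `α`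
(`inGenericPosition_iff`). The degree in question is `nα - n - 1 = n(α - 1) - 1`.

If `I_𝕏` starts in degree at least `α`, all partial derivatives of its elements have order at least
`α - 1`. Hence so do all coefficients of relations between `dx₁, …, dxₙ`, and `n × n` determinants
of such relations have order at least `n(α - 1)` (`initialFittingIdeal_le_pow`,
`kaehlerDifferent_le`).

Otherwise take a form `g ≠ 0` in `I_𝕏` of minimal degree `d < α`. The characteristic does not divide
`d`, so by Euler and minimality some partial derivative of `g` is non-zero at a point `z` of `𝕏`.
The Jacobian matrix of `F₁, …, Fₙ` is invertible at `z`, so replacing a suitable row by the gradient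
of `X₀^(α-1-d) g` leaves it invertible. This determinant lies in the different, has degree `n(α - 1)
- 1` and is non-zero at `z` (`hilbertFunction_kaehlerDifferent_ne_zero`).

Invertibility is the transversality half of Bézout's theorem (`eq_zero_of_tangent_of_card_zeros`).
With a linear form `l` vanishing at no common zero, `k[X]` is finite over `k[l^a, F₁, …, Fₙ]`, and a
dimension count bounds the degree of the minimal polynomial of a form of degree `a` by `a ^ n`.
Specialised at `(1, 0, …, 0)` it has `a ^ n` distinct roots, so all are simple; a tangent vector
would make one double. -/

noncomputable section

/-! ### Dimensions of spaces of forms -/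

theorem MvPolynomial.finrank_homogeneousSubmodule {K σ : Type*} [Field K] [Fintype σ] {n : ℕ}
    (hσ : Fintype.card σ = n + 1) (d : ℕ) :
    Module.finrank K (homogeneousSubmodule σ K d) = (n + d).choose n := by
  classical
  have e : {x : σ →₀ ℕ | x.degree = d} ≃ Sym σ d :=
    (Equiv.subtypeEquivRight fun x => by rw [Set.mem_ofPred_eq, Finsupp.degree_apply]; rfl).trans
      (Sym.equivNatSum σ d).symm
  rw [homogeneousSubmodule_eq_finsupp_supported,
    LinearEquiv.finrank_eq (AddMonoidAlgebra.supportedEquivFinsupp _)]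
  have : Fintype {x : σ →₀ ℕ | x.degree = d} := Fintype.ofEquiv _ e.symm
  rw [Module.finrank_finsupp_self, Fintype.card_congr e, Sym.card_sym_eq_choose, hσ,
    Nat.add_right_comm, Nat.add_sub_cancel, Nat.choose_symm_add]

theorem MvPolynomial.finite_homogeneousSubmodule (K σ : Type*) [Field K] [Finite σ] (d : ℕ) :
    Module.Finite K (homogeneousSubmodule σ K d) :=
  Module.Finite.of_fg (homogeneousSubmodule_fg σ K d)

/-- As polynomials in `s`, the two sides have leading coefficients `a ^ n / n!` and `(a ^ n + 1) /
n!`. This is the dimension count that forces a relation of degree at most `a ^ n`. -/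
theorem exists_choose_lt_mul_choose (n a : ℕ) (ha : 0 < a) :
    ∃ s : ℕ, (n + a * (s + a ^ n)).choose n < (a ^ n + 1) * (n + s).choose n := by
  obtain ⟨D, hD⟩ : ∃ D, D = a ^ n + n := ⟨_, rfl⟩
  have hlim : Filter.Tendsto (fun t : ℕ => (1 + (D : ℝ) / t) ^ n) Filter.atTop (nhds 1) := by
    simpa using ((tendsto_const_div_atTop_nhds_zero_nat (D : ℝ)).const_add 1).pow n
  have hN : (0 : ℝ) < (a : ℝ) ^ n := by positivity
  have hlt : (1 : ℝ) < ((a : ℝ) ^ n + 1) / (a : ℝ) ^ n := by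
    rw [lt_div_iff₀ hN]; linarith
  obtain ⟨t, ht, ht1⟩ := ((hlim.eventually_lt_const hlt).and (Filter.eventually_ge_atTop 1)).exists
  obtain ⟨s, rfl⟩ : ∃ s, t = s + 1 := ⟨t - 1, by omega⟩
  refine ⟨s, ?_⟩
  have hs : (0 : ℝ) < (s + 1 : ℕ) := by positivity
  rw [lt_div_iff₀ hN, one_add_div hs.ne', div_pow, div_mul_eq_mul_div, div_lt_iff₀ (by positivity),
    ← mul_pow] at ht
  have h1 := Nat.choose_le_pow_div (α := ℝ) n (n + a * (s + a ^ n))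
  have h2 := Nat.pow_le_choose (α := ℝ) n (n + s)
  have hf : (0 : ℝ) < n.factorial := by positivity
  rw [le_div_iff₀ hf] at h1
  rw [div_le_iff₀ hf] at h2
  have h3 : n + a * (s + a ^ n) ≤ (s + 1 + D) * a := by
    subst hD
    nlinarith [Nat.le_mul_of_pos_right n ha]
  have h4 : ((n + a * (s + a ^ n) : ℕ) : ℝ) ^ n ≤ (((s + 1 : ℕ) + D) * a : ℝ) ^ n := by
    gcongr
    exact_mod_cast h3
  rw [show n + s + 1 - n = s + 1 by omega] at h2
  have h5 := mul_le_mul_of_nonneg_left h2 (by positivity : (0 : ℝ) ≤ (a : ℝ) ^ n + 1)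
  have h6 : ((n + a * (s + a ^ n)).choose n : ℝ) * n.factorial <
      ((a ^ n + 1) * (n + s).choose n) * n.factorial := by
    calc _ ≤ _ := h1
      _ ≤ _ := h4
      _ < _ := ht
      _ ≤ _ := by push_cast at h5 ⊢; linarith
  exact_mod_cast lt_of_mul_lt_mul_right h6 hf.le

section HomogeneousComponent

variable {R σ : Type*} [CommRing R]

theorem MvPolynomial.homogeneousComponent_mul_of_le {f : MvPolynomial σ R} {a d : ℕ}
    (hf : f.IsHomogeneous a) (had : a ≤ d) (g : MvPolynomial σ R) :
    homogeneousComponent d (f * g) = f * homogeneousComponent (d - a) g := by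
  rw [← decomposition.decompose'_apply, ← decomposition.decompose'_apply]
  exact DirectSum.coe_decompose_mul_of_left_mem_of_le (homogeneousSubmodule σ R) hf had

theorem MvPolynomial.IsHomogeneous.mem_pow_idealOfVars {f : MvPolynomial σ R} {d e : ℕ}
    (hf : f.IsHomogeneous d) (hed : e ≤ d) : f ∈ idealOfVars σ R ^ e := by
  rw [mem_pow_idealOfVars_iff']
  intro x hx
  exact hf.coeff_eq_zero (by omega)

end HomogeneousComponent

/-! ### Finiteness and algebraic relations over algebras generated by forms -/

section Forms

variable {k : Type*} [Field k] {σ : Type*}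

/-- First-order Taylor expansion at `p + εv`. -/
theorem MvPolynomial.aeval_inl_add_inr (p v : σ → k) [Fintype σ] (f : MvPolynomial σ k) :
    aeval (fun i => (TrivSqZeroExt.inl (p i) + TrivSqZeroExt.inr (v i) : DualNumber k)) f =
      TrivSqZeroExt.inl (eval p f) + TrivSqZeroExt.inr (∑ i, v i * eval p (pderiv i f)) := by
  classical
  induction f using MvPolynomial.induction_on with
  | C a => simp [TrivSqZeroExt.algebraMap_eq_inl]
  | add f g hf hg =>
    rw [map_add, hf, hg]
    ext <;> simp [mul_add, Finset.sum_add_distrib]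
  | mul_X f i hf =>
    rw [map_mul, hf, aeval_X]
    ext
    · simp
    · simp [mul_add, Finset.sum_add_distrib, pderiv_X, Pi.single_apply, apply_ite (eval p),
        Finset.sum_mul]
      rw [add_comm]
      congr 1
      exact Finset.sum_congr rfl fun _ _ => by ring

/-- By the Nullstellensatz the forms generate an ideal containing a power `D` of the irrelevant
ideal; a graded Nakayama argument then shows that the monomials of degree below `D + a` generate the
module. -/
theorem MvPolynomial.aeval_finite_of_zeros_eq_zero [IsAlgClosed k] [Finite σ] {κ : Type*}
    [Finite κ] {a : ℕ} (ha : 0 < a) (G : κ → MvPolynomial σ k) (hG : ∀ j, (G j).IsHomogeneous a)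
    (hzero : ∀ z : σ → k, (∀ j, eval z (G j) = 0) → z = 0) :
    (aeval G : MvPolynomial κ k →ₐ[k] MvPolynomial σ k).toRingHom.Finite := by
  classical
  set φ := (aeval G : MvPolynomial κ k →ₐ[k] MvPolynomial σ k).toRingHom with hφ
  have hφX : ∀ j, φ (X j) = G j := fun j => by simp [hφ]
  have := Fintype.ofFinite κ
  have hrad : idealOfVars σ k ≤ (Ideal.span (Set.range G)).radical := by
    rw [← MvPolynomial.vanishingIdeal_zeroLocus_eq_radical (K := k), idealOfVars, Ideal.span_le]
    rintro _ ⟨i, rfl⟩ z hz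
    have : z = 0 := hzero z fun j => by
      simpa [coe_aeval_eq_eval] using hz (G j) (Ideal.subset_span ⟨j, rfl⟩)
    simp [this]
  obtain ⟨D, hD⟩ := Ideal.exists_pow_le_of_le_radical_of_fg hrad (idealOfVars_fg σ k)
  let _ := φ.toAlgebra
  have hsmul : ∀ (c : MvPolynomial κ k) (f : MvPolynomial σ k), c • f = φ c * f :=
    fun c f => Algebra.smul_def c f
  have hfin : ((fun x => monomial x (1 : k)) '' {x : σ →₀ ℕ | x.degree < D + a}).Finite :=
    (Finsupp.finite_of_degree_lt _).image _
  set S := Submodule.span (MvPolynomial κ k)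
    ((fun x => monomial x (1 : k)) '' {x : σ →₀ ℕ | x.degree < D + a}) with hS
  have key : ∀ d, ∀ f : MvPolynomial σ k, f.IsHomogeneous d → f ∈ S := by
    intro d
    induction d using Nat.strong_induction_on with
    | _ d ih =>
    intro f hf
    by_cases hdD : d < D + a
    · rw [f.as_sum]
      refine Submodule.sum_mem _ fun x hx => ?_
      have hx' : x.degree = d := by
        by_contra h
        exact mem_support_iff.mp hx (hf.coeff_eq_zero h)
      have : monomial x (coeff x f) = (C (coeff x f) : MvPolynomial κ k) • (monomial x (1 : k)) := by
        simp [hsmul, hφ, algebraMap_eq, C_mul_monomial]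
      rw [this]
      exact Submodule.smul_mem _ _ (Submodule.subset_span ⟨x, lt_of_eq_of_lt hx' hdD, rfl⟩)
    · have hf' : f ∈ Ideal.span (Set.range G) := hD (hf.mem_pow_idealOfVars (by omega))
      rw [Ideal.mem_span_range_iff_exists_fun] at hf'
      obtain ⟨c, rfl⟩ := hf'
      rw [← homogeneousComponent_eq_self hf, map_sum]
      refine Submodule.sum_mem _ fun j _ => ?_
      rw [mul_comm, homogeneousComponent_mul_of_le (hG j) (by omega), ← hφX, ← hsmul]
      exact Submodule.smul_mem _ _ (ih (d - a) (by omega) _ (homogeneousComponent_isHomogeneous _ _))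
  change Module.Finite (MvPolynomial κ k) (MvPolynomial σ k)
  refine Module.finite_def.mpr ⟨hfin.toFinset, ?_⟩
  rw [Set.Finite.coe_toFinset, ← hS, eq_top_iff]
  intro f _
  rw [← sum_homogeneousComponent f]
  exact Submodule.sum_mem _ fun d _ => key d _ (homogeneousComponent_isHomogeneous _ _)

-- Integrality makes the `G j` generate up to algebraic extension, and a generating family of this
-- kind with as many members as the transcendence degree is a transcendence basis.
open Algebra in
theorem MvPolynomial.algebraicIndependent_of_finite_aeval {κ : Type*}
    [Finite κ] [Finite σ] (hκ : Nat.card κ = Nat.card σ) (G : κ → MvPolynomial σ k)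
    (h : (aeval G : MvPolynomial κ k →ₐ[k] MvPolynomial σ k).toRingHom.Finite) :
    AlgebraicIndependent k G := by
  have : Algebra.IsIntegral (Algebra.adjoin k (Set.range G)) (MvPolynomial σ k) := by
    refine ⟨fun f => ?_⟩
    obtain ⟨q, hq, hqf⟩ := h.to_isIntegral f
    refine ⟨q.map ((aeval G).codRestrict (Algebra.adjoin k (Set.range G)) fun x => ?_).toRingHom,
      hq.map _, ?_⟩
    · rw [Algebra.adjoin_range_eq_range_aeval]
      exact ⟨x, rfl⟩
    · rw [Polynomial.eval₂_map]
      exact hqf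
  refine (IsAlgebraic.isTranscendenceBasis_of_lift_le_trdeg_of_finite k G ?_).1
  rw [MvPolynomial.trdeg_of_isDomain]
  simp only [Cardinal.lift_lift]
  rw [← Nat.cast_card (α := κ), ← Nat.cast_card (α := σ), hκ]
  simp

/-- A form `u` of degree `a` in `n + 1` variables satisfies a non-trivial polynomial relation of
degree at most `a ^ n` over the algebra generated by `n + 1` given forms of degree `a`. -/
theorem MvPolynomial.exists_eval₂_eq_zero_of_isHomogeneous {n a : ℕ} {κ : Type*} [Fintype κ] [Fintype σ]
    (hκ : Fintype.card κ = n + 1) (hσ : Fintype.card σ = n + 1) (ha : 0 < a)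
    (G : κ → MvPolynomial σ k) (hG : ∀ j, (G j).IsHomogeneous a)
    (u : MvPolynomial σ k) (hu : u.IsHomogeneous a) :
    ∃ q : Polynomial (MvPolynomial κ k), q ≠ 0 ∧ q.natDegree ≤ a ^ n ∧
      q.eval₂ (aeval G : MvPolynomial κ k →ₐ[k] MvPolynomial σ k).toRingHom u = 0 := by
  classical
  obtain ⟨s, hs⟩ := exists_choose_lt_mul_choose n a ha
  have : Nonempty κ := by rw [← Fintype.card_pos_iff]; omega
  obtain ⟨j₀⟩ := this
  -- The powers of `G j₀` make every summand homogeneous of the same degree `a * (s + a ^ n)`. A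
  -- kernel element gives the coefficients of the relation.
  let Φ : (Fin (a ^ n + 1) → homogeneousSubmodule κ k s) →ₗ[k]
      homogeneousSubmodule σ k (a * (s + a ^ n)) :=
    LinearMap.codRestrict _ (∑ c : Fin (a ^ n + 1),
      ((LinearMap.mulRight k (G j₀ ^ (a ^ n - c) * u ^ (c : ℕ))) ∘ₗ
        (aeval G : MvPolynomial κ k →ₐ[k] MvPolynomial σ k).toLinearMap ∘ₗ
        (homogeneousSubmodule κ k s).subtype ∘ₗ LinearMap.proj c)) fun h => by
      rw [LinearMap.sum_apply]
      refine Submodule.sum_mem _ fun c _ => ?_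
      have h1 := ((h c).2 : IsHomogeneous _ _).aeval (R := k) G hG
      have h2 := ((hG j₀).pow (a ^ n - c)).mul (hu.pow c)
      have h3 := h1.mul h2
      have hc := c.2
      rw [← mul_add, ← mul_add, show s + (a ^ n - c + c) = s + a ^ n by omega] at h3
      exact h3
  have := finite_homogeneousSubmodule k κ s
  have := finite_homogeneousSubmodule k σ (a * (s + a ^ n))
  have hker : LinearMap.ker Φ ≠ ⊥ := by
    refine LinearMap.ker_ne_bot_of_finrank_lt ?_
    rw [Module.finrank_pi_fintype]
    simpa [finrank_homogeneousSubmodule hκ, finrank_homogeneousSubmodule hσ] using hs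
  obtain ⟨h, hh, hne⟩ := Submodule.exists_mem_ne_zero_of_ne_bot hker
  obtain ⟨c₀, hc₀⟩ := Function.ne_iff.mp hne
  refine ⟨∑ c : Fin (a ^ n + 1), Polynomial.monomial (c : ℕ)
    ((h c : MvPolynomial κ k) * X j₀ ^ (a ^ n - c)), fun h0 => ?_, ?_, ?_⟩
  · have := congrArg (fun q => Polynomial.coeff q c₀) h0
    simp [Polynomial.finsetSum_coeff, Polynomial.coeff_monomial, Fin.val_inj] at this
    exact hc₀ this
  · refine Polynomial.natDegree_sum_le_of_forall_le _ _ fun c _ => ?_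
    exact (Polynomial.natDegree_monomial_le _).trans (by omega)
  · have := congrArg Subtype.val (LinearMap.mem_ker.mp hh)
    rw [Polynomial.eval₂_finsetSum]
    refine Eq.trans ?_ this
    rw [LinearMap.codRestrict_apply, LinearMap.sum_apply]
    refine Finset.sum_congr rfl fun c _ => ?_
    simp [Polynomial.eval₂_monomial, mul_assoc]

end Forms

/-! ### Transversality from the number of common zeros -/

section Tangent

/-- The distinct roots `r i` already exhaust the degree, so `q` is the product of the `X - r i` and
is separable. -/
theorem Polynomial.derivative_eval_ne_zero_of_card_le {k ι : Type*} [Field k] [Fintype ι]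
    {q : Polynomial k} (hq : q.Monic) (hdeg : q.natDegree ≤ Fintype.card ι) {r : ι → k}
    (hr : Function.Injective r) (hroot : ∀ i, q.eval (r i) = 0) (i : ι) :
    q.derivative.eval (r i) ≠ 0 := by
  have hdvd : ∏ i, (Polynomial.X - Polynomial.C (r i)) ∣ q :=
    Finset.prod_dvd_of_coprime
      (fun i _ j _ hij => Polynomial.isCoprime_X_sub_C_of_isUnit_sub
        (isUnit_iff_ne_zero.mpr (sub_ne_zero.mpr (hr.ne hij))))
      fun i _ => Polynomial.dvd_iff_isRoot.mpr (hroot i)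
  have hmonic : (∏ i, (Polynomial.X - Polynomial.C (r i))).Monic :=
    Polynomial.monic_prod_of_monic _ _ fun i _ => Polynomial.monic_X_sub_C _
  have heq := Polynomial.eq_of_monic_of_dvd_of_natDegree_le hmonic hq hdvd (by
    rw [Polynomial.natDegree_prod_of_monic _ _ fun i _ => Polynomial.monic_X_sub_C _]
    simpa using hdeg)
  have hsep : q.Separable := heq ▸ Polynomial.separable_prod_X_sub_C_iff.mpr hr
  have := hsep.aeval_derivative_ne_zero (x := r i) (by simpa using hroot i)
  simpa using this

theorem MvPolynomial.exists_isHomogeneous_one_eval_eq {k : Type*} [Field k] {σ : Type*} [Fintype σ]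
    (f : Module.Dual k (σ → k)) :
    ∃ l : MvPolynomial σ k, l.IsHomogeneous 1 ∧ (∀ z, eval z l = f z) ∧
      ∀ p v : σ → k, ∑ i, v i * eval p (pderiv i l) = f v := by
  classical
  have hf : ∀ z, f z = ∑ i, z i * f (Pi.single i 1) := fun z => by
    conv_lhs => rw [← Finset.univ_sum_single z, map_sum]
    refine Finset.sum_congr rfl fun i _ => ?_
    rw [← smul_eq_mul, ← map_smul, ← Pi.single_smul, smul_eq_mul, mul_one]
  refine ⟨∑ i, C (f (Pi.single i 1)) * X i, IsHomogeneous.sum _ _ _ fun i _ =>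
    isHomogeneous_C_mul_X _ _, fun z => ?_, fun p v => ?_⟩
  · rw [hf z]
    simp [mul_comm]
  · rw [hf v]
    simp [pderiv_X, Pi.single_apply]

/-- If `n` forms of degree `a` meet in precisely `a ^ n` distinct points of `ℙⁿ`, normalised here
by a linear form `f` that vanishes at none of them, then no non-zero vector in the hyperplane
`f = 0` is tangent to all the forms at one of these points. -/
theorem eq_zero_of_tangent_of_card_zeros {k : Type*} [Field k] [IsAlgClosed k] {n a : ℕ}
    (ha : 0 < a) {F : Fin n → MvPolynomial (Fin (n + 1)) k} (hF : ∀ j, (F j).IsHomogeneous a)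
    {ι : Type*} [Fintype ι] (hι : Fintype.card ι = a ^ n) {p : ι → Fin (n + 1) → k}
    (hp : Function.Injective p) (f : Module.Dual k (Fin (n + 1) → k)) (hf : ∀ i, f (p i) = 1)
    (hpF : ∀ i j, eval (p i) (F j) = 0)
    (hzero : ∀ z, (∀ j, eval z (F j) = 0) → f z = 0 → z = 0) (i₀ : ι) {v : Fin (n + 1) → k}
    (hfv : f v = 0) (hv : ∀ j, ∑ m, v m * eval (p i₀) (pderiv m (F j)) = 0) : v = 0 := by
  classical
  by_contra hv0
  -- A linear form that separates the points and does not kill `v`; only finitely many non-zero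
  -- vectors have to be avoided.
  obtain ⟨g, hg⟩ := Module.exists_dual_forall_apply_ne_zero (K := k)
    (fun o : Option {x : ι × ι // x.1 ≠ x.2} => o.elim v fun x => p x.1.1 - p x.1.2) (by
      rintro (_ | ⟨x, hx⟩)
      · exact hv0
      · exact sub_ne_zero.mpr (hp.ne hx))
  have hgv : g v ≠ 0 := hg none
  have hginj : Function.Injective fun i => g (p i) := fun i j hij => by
    by_contra hne
    exact hg (some ⟨(i, j), hne⟩) (by simpa [sub_eq_zero] using hij)
  obtain ⟨l, hl, hlf, hlv⟩ := exists_isHomogeneous_one_eval_eq f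
  obtain ⟨u', hu', hug, huv⟩ := exists_isHomogeneous_one_eval_eq g
  set G : Option (Fin n) → MvPolynomial (Fin (n + 1)) k := fun o => o.elim (l ^ a) F with hGdef
  have hG : ∀ o, (G o).IsHomogeneous a := by
    rintro (_ | j)
    · have := hl.pow a
      rwa [one_mul] at this
    · exact hF j
  set u := l ^ (a - 1) * u' with hu
  have huhom : u.IsHomogeneous a := by
    have := (hl.pow (a - 1)).mul hu'
    rwa [one_mul, Nat.sub_add_cancel ha] at this
  set φ : MvPolynomial (Option (Fin n)) k →ₐ[k] MvPolynomial (Fin (n + 1)) k := aeval G with hφ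
  have hfin : φ.toRingHom.Finite := aeval_finite_of_zeros_eq_zero ha G hG fun z hz =>
    hzero z (fun j => hz (some j)) (by
      have := hz none
      simpa [hGdef, hlf, ha.ne'] using this)
  have hinj : Function.Injective φ :=
    algebraicIndependent_of_finite_aeval (by simp) G hfin
  obtain ⟨q₀, hq₀, hq₀deg, hq₀u⟩ := exists_eval₂_eq_zero_of_isHomogeneous (n := n)
    (by simp) (by simp) ha G hG u huhom
  let _ := φ.toRingHom.toAlgebra
  have : IsDomain (MvPolynomial (Option (Fin n)) k) := inferInstance
  have htf : Module.IsTorsionFree (MvPolynomial (Option (Fin n)) k) (MvPolynomial (Fin (n + 1)) k) := by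
    have : FaithfulSMul (MvPolynomial (Option (Fin n)) k) (MvPolynomial (Fin (n + 1)) k) :=
      (faithfulSMul_iff_algebraMap_injective _ _).mpr hinj
    infer_instance
  have hint : IsIntegral (MvPolynomial (Option (Fin n)) k) u := hfin.to_isIntegral u
  -- The relation `q₀` need not be monic. Over the integrally closed polynomial ring the minimal
  -- polynomial is monic by integrality and of degree at most that of `q₀`.
  obtain ⟨q, hqm, hqdeg, hqu⟩ : ∃ q : Polynomial (MvPolynomial (Option (Fin n)) k), q.Monic ∧
      q.natDegree ≤ a ^ n ∧ q.eval₂ φ.toRingHom u = 0 :=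
    ⟨minpoly _ u, minpoly.monic hint,
      (Polynomial.natDegree_le_natDegree
        (minpoly.IsIntegrallyClosed.degree_le_of_ne_zero hq₀ hq₀u)).trans hq₀deg,
      minpoly.aeval _ u⟩
  set ev : MvPolynomial (Option (Fin n)) k →+* k := eval fun o => o.elim 1 0 with hev
  have hroot : ∀ i, (q.map ev).eval (g (p i)) = 0 := by
    intro i
    have hcomp : (eval (p i)).comp φ.toRingHom = ev := by
      refine MvPolynomial.ringHom_ext (fun c => by simp [hφ, hev, algebraMap_eq]) ?_
      rintro (_ | j)
      · simp [hφ, hev, hGdef, hlf, hf]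
      · simp [hφ, hev, hGdef, hpF]
    have := congrArg (eval (p i)) hqu
    rw [Polynomial.hom_eval₂, hcomp, map_zero, hu, map_mul, map_pow, hlf, hf, one_pow, one_mul,
      hug] at this
    rwa [Polynomial.eval_map]
  have hder := Polynomial.derivative_eval_ne_zero_of_card_le (hqm.map ev)
    ((Polynomial.natDegree_map_le).trans (hqdeg.trans hι.ge)) hginj hroot i₀
  -- Evaluation at `p i₀ + εv`. It sends `l` to `1` and, by tangency, each `F j` to `0`, so it
  -- specialises the coefficients of `q` as `ev` does.
  set δ := aeval (R := k) (fun m => (TrivSqZeroExt.inl (p i₀ m) + TrivSqZeroExt.inr (v m) : DualNumber k))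
    with hδ
  have hδl : δ l = 1 := by
    rw [hδ, aeval_inl_add_inr, hlf, hf, hlv, hfv]
    simp
  have hδu : δ u = TrivSqZeroExt.inl (g (p i₀)) + TrivSqZeroExt.inr (g v) := by
    rw [hu, map_mul, map_pow, hδl, one_pow, one_mul, hδ, aeval_inl_add_inr, hug, huv]
  have hcomp : δ.toRingHom.comp φ.toRingHom = (algebraMap k (DualNumber k)).comp ev := by
    refine MvPolynomial.ringHom_ext (fun c => by simp [hφ, hev]) ?_
    rintro (_ | j)
    · simp [hφ, hev, hGdef, hδl]
    · have : δ (F j) = 0 := by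
        rw [hδ, aeval_inl_add_inr, hpF, hv]
        simp
      simp [hφ, hev, hGdef, this]
  have h0 := congrArg δ.toRingHom hqu
  rw [Polynomial.hom_eval₂, hcomp, map_zero, ← Polynomial.eval₂_map] at h0
  change Polynomial.aeval (δ u) (q.map ev) = 0 at h0
  rw [hδu, Polynomial.aeval_add_of_sq_eq_zero _ _ _ (by simp [sq]),
    ← TrivSqZeroExt.algebraMap_eq_inl, Polynomial.aeval_algebraMap_apply,
    Polynomial.aeval_algebraMap_apply] at h0
  -- The `ε`-part reads `q'(g (p i₀)) * g v = 0`.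
  have h1 := congrArg TrivSqZeroExt.snd h0
  simp [TrivSqZeroExt.algebraMap_eq_inl, hgv] at h1
  exact hder (by simpa using h1)

end Tangent

/-! ### Points of projective space and the affine Jacobian -/

section Points

theorem MvPolynomial.aeval_smul_of_isHomogeneous {R S σ : Type*} [CommRing R] [CommRing S]
    [Algebra R S] {h : MvPolynomial σ R} {d : ℕ} (hh : h.IsHomogeneous d) (c : S) (z : σ → S) :
    aeval (c • z) h = c ^ d * aeval z h := by
  rw [aeval_def, aeval_def, eval₂_eq, eval₂_eq, Finset.mul_sum]
  refine Finset.sum_congr rfl fun x hx => ?_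
  have hx' : ∑ i ∈ x.support, x i = d := by
    rw [← Finsupp.degree_apply]
    by_contra hne
    exact mem_support_iff.mp hx (hh.coeff_eq_zero hne)
  simp only [Pi.smul_apply, smul_eq_mul, mul_pow, Finset.prod_mul_distrib,
    Finset.prod_pow_eq_pow_sum, hx']
  ring

variable {L M : Type*} [Field L] [Field M] [Algebra L M] {n : ℕ}

/-- The point of `ℙⁿ_L` below the point `(z₀ : … : zₙ)` of `ℙⁿ_M`, for a field extension
`L ⊆ M`. -/
def projectivePoint (L : Type*) [Field L] [Algebra L M] (z : Fin (n + 1) → M) (hz : z ≠ 0) :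
    ProjectiveSpectrum (homogeneousSubmodule (Fin (n + 1)) L) where
  asHomogeneousIdeal := (RingHom.ker (aeval (R := L) z)).homogeneousCore _
  isPrime := (RingHom.ker_isPrime _).homogeneousCore
  not_irrelevant_le := fun h => by
    obtain ⟨i, hi⟩ := Function.ne_iff.mp hz
    have hX : (X i : MvPolynomial (Fin (n + 1)) L) ∈
        HomogeneousIdeal.irrelevant (homogeneousSubmodule (Fin (n + 1)) L) := by
      rw [HomogeneousIdeal.mem_irrelevant_iff, GradedRing.proj_apply,
        DirectSum.decompose_of_mem_ne (homogeneousSubmodule (Fin (n + 1)) L) (isHomogeneous_X L i)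
          one_ne_zero]
    have := Ideal.toIdeal_homogeneousCore_le _ _ (h hX)
    exact hi (by simpa using this)

theorem mem_projectivePoint_iff {z : Fin (n + 1) → M} (hz : z ≠ 0) {d : ℕ}
    {f : MvPolynomial (Fin (n + 1)) L} (hf : f.IsHomogeneous d) :
    f ∈ (projectivePoint L z hz).asHomogeneousIdeal ↔ aeval z f = 0 :=
  ⟨fun h => Ideal.toIdeal_homogeneousCore_le _ _ h, fun h =>
    Ideal.mem_homogeneousCore_of_homogeneous_of_mem ⟨d, hf⟩ h⟩

theorem MvPolynomial.sum_mul_eval_pderiv {k σ : Type*} [Field k] [Fintype σ] {d : ℕ}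
    {h : MvPolynomial σ k} (hh : h.IsHomogeneous d) (z : σ → k) :
    ∑ i, z i * eval z (pderiv i h) = d * eval z h := by
  simpa using congrArg (eval z) hh.sum_X_mul_pderiv

/-- If `n` forms of degree `a` meet in precisely `a ^ n` distinct points of `ℙⁿ`, then their
affine Jacobian matrix is invertible at each of these points. -/
theorem det_jacobian_ne_zero_of_card_zeros {k : Type*} [Field k] [IsAlgClosed k] {n a : ℕ}
    (ha : 0 < a) {F : Fin n → MvPolynomial (Fin (n + 1)) k} (hF : ∀ j, (F j).IsHomogeneous a)
    {ι : Type*} [Fintype ι] (hι : Fintype.card ι = a ^ n) {p : ι → Fin (n + 1) → k}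
    (hp0 : ∀ i, p i ≠ 0) (hpF : ∀ i j, eval (p i) (F j) = 0)
    (hne : ∀ i j, ∀ c : k, p i = c • p j → i = j)
    (hall : ∀ z, z ≠ 0 → (∀ j, eval z (F j) = 0) → ∃ i, ∃ c : k, z = c • p i)
    {z : Fin (n + 1) → k} (hz0 : z 0 ≠ 0) (hz : ∀ j, eval z (F j) = 0) :
    (Matrix.of fun i j : Fin n => eval z (pderiv j.succ (F i))).det ≠ 0 := by
  intro hdet
  obtain ⟨y, hy, hyM⟩ := Matrix.exists_mulVec_eq_zero_iff.mpr hdet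
  obtain ⟨f, hf⟩ := Module.exists_dual_forall_apply_ne_zero (K := k) p hp0
  obtain ⟨i₀, c₀, hc₀⟩ := hall z (fun h => hz0 (by simp [h])) hz
  have hev : ∀ (h : MvPolynomial (Fin (n + 1)) k) (d : ℕ), h.IsHomogeneous d → ∀ (c : k) w,
      eval (c • w) h = c ^ d * eval w h := fun h d hh c w => by
    simpa [coe_aeval_eq_eval] using aeval_smul_of_isHomogeneous hh c w
  obtain ⟨p', hp'⟩ : ∃ p' : ι → Fin (n + 1) → k, ∀ i, p' i = (f (p i))⁻¹ • p i := ⟨_, fun _ => rfl⟩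
  have hp'f : ∀ i, f (p' i) = 1 := fun i => by rw [hp', map_smul, smul_eq_mul, inv_mul_cancel₀ (hf i)]
  have hp'F : ∀ i j, eval (p' i) (F j) = 0 := fun i j => by
    rw [hp', hev _ _ (hF j), hpF, mul_zero]
  have hp'i : ∀ i, p i = f (p i) • p' i := fun i => by rw [hp', smul_inv_smul₀ (hf i)]
  have hinj : Function.Injective p' := fun i j hij => by
    refine hne i j (f (p i) * (f (p j))⁻¹) ?_
    rw [mul_smul, ← hp', ← hij, ← hp'i]
  have hzp : z = (c₀ * f (p i₀)) • p' i₀ := by rw [hc₀, mul_smul, ← hp'i]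
  have hc : c₀ * f (p i₀) ≠ 0 := fun h => hz0 (by rw [hzp, h, zero_smul]; rfl)
  have hp'0 : p' i₀ 0 ≠ 0 := fun h => hz0 (by rw [hzp, Pi.smul_apply, h, smul_zero])
  have htan : ∀ j, ∑ m, (Fin.cons 0 y : Fin (n + 1) → k) m * eval (p' i₀) (pderiv m (F j)) = 0 := by
    intro j
    have := congrFun hyM j
    simp only [Matrix.mulVec, dotProduct, Matrix.of_apply, Pi.zero_apply] at this
    rw [Fin.sum_univ_succ]
    simp only [Fin.cons_zero, zero_mul, Fin.cons_succ, zero_add]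
    rw [hzp] at this
    simp only [hev _ _ ((hF j).pderiv), mul_assoc, ← Finset.mul_sum] at this
    rw [mul_eq_zero, or_iff_right (pow_ne_zero _ hc)] at this
    simpa only [mul_comm] using this
  have hv := eq_zero_of_tangent_of_card_zeros ha hF hι hinj f hp'f hp'F (fun w hw hfw => by
    by_contra hw0
    obtain ⟨i, c, rfl⟩ := hall w hw0 hw
    rw [map_smul, smul_eq_mul, mul_eq_zero, or_iff_left (hf i)] at hfw
    exact hw0 (by rw [hfw, zero_smul])) i₀
    -- By Euler's formula `p' i₀` is itself tangent at the zero `p' i₀`, so subtracting a multiple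
    -- of it moves the kernel vector into `f = 0` and keeps it tangent.
    (v := Fin.cons 0 y - f (Fin.cons 0 y) • p' i₀) (by simp [hp'f]) (fun j => by
      have := sum_mul_eval_pderiv (hF j) (p' i₀)
      rw [hp'F, mul_zero] at this
      simp only [Pi.sub_apply, Pi.smul_apply, smul_eq_mul, sub_mul, Finset.sum_sub_distrib, htan,
        mul_assoc, ← Finset.mul_sum, this, mul_zero, sub_zero])
  have h0 := congrFun hv 0
  simp only [Pi.sub_apply, Fin.cons_zero, Pi.smul_apply, smul_eq_mul, Pi.zero_apply, zero_sub,
    neg_eq_zero, mul_eq_zero, or_iff_left hp'0] at h0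
  rw [h0, zero_smul, sub_zero] at hv
  exact hy (funext fun i => by simpa using congrFun hv i.succ)

/-- Every common zero over `M` lies above an `L`-rational point, hence is a multiple of its
representative. So there are still exactly `a ^ n` zeros over `M`. -/
theorem det_jacobian_ne_zero_of_meetInRationalPoints {K : Type u} {L : Type v} {M : Type*} [Field K]
    [Field L] [Field M] [Algebra K L] [Algebra L M] [Algebra K M] [IsScalarTower K L M]
    [IsAlgClosed M] {n a : ℕ} (ha : 0 < a) {F : Fin n → MvPolynomial (Fin (n + 1)) K}
    (hF : ∀ j, (F j).IsHomogeneous a) (hmeet : MeetInRationalPoints L F (a ^ n))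
    {z : Fin (n + 1) → M} (hz0 : z 0 ≠ 0) (hz : ∀ j, aeval z (F j) = 0) :
    (Matrix.of fun i j : Fin n => aeval z (pderiv j.succ (F i))).det ≠ 0 := by
  obtain ⟨hcard, hrat⟩ := hmeet
  have hfin : (commonZeros L F).Finite := Set.finite_of_encard_eq_coe hcard
  have := hfin.fintype
  choose w hw0 hw using fun x : commonZeros L F => hrat x x.2
  have hmap : ∀ (f : MvPolynomial (Fin (n + 1)) K) (y : Fin (n + 1) → M),
      eval y (map (algebraMap K M) f) = aeval y f := fun f y => by
    rw [eval_map, aeval_def]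
  have hmapL : ∀ (f : MvPolynomial (Fin (n + 1)) L) (y : Fin (n + 1) → L),
      aeval (algebraMap L M ∘ y) f = algebraMap L M (eval y f) := fun f y => by
    rw [← coe_aeval_eq_eval, RingHom.coe_coe, ← aeval_algebraMap_apply]
  have htower : ∀ (f : MvPolynomial (Fin (n + 1)) K) (y : Fin (n + 1) → M),
      aeval y (map (algebraMap K L) f) = aeval y f := fun f y => aeval_map_algebraMap L y f
  have hinj := (algebraMap L M).injective
  simp only [← hmap, ← pderiv_map]
  refine det_jacobian_ne_zero_of_card_zeros ha (F := fun j => map (algebraMap K M) (F j))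
    (fun j => (hF j).map _) (ι := commonZeros L F) (p := fun x => algebraMap L M ∘ w x) ?_ ?_ ?_ ?_ ?_
    hz0 (fun j => by rw [hmap, hz])
  · rw [← Set.toFinset_card, ← Nat.cast_inj (R := ℕ∞), ← Set.encard_eq_coe_toFinset_card, hcard]
  · intro x h
    refine hw0 x (funext fun i => hinj ?_)
    simpa using congrFun h i
  · intro x j
    rw [hmap, ← htower, hmapL, (hw x a _ ((hF j).map _)).mp (x.2 ⟨j, rfl⟩), map_zero]
  · intro x y c hxy
    refine Subtype.ext (ProjectiveSpectrum.ext (HomogeneousIdeal.ext' fun d f hf => ?_))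
    rw [hw x d f hf, hw y d f hf, ← map_eq_zero_iff _ hinj, ← map_eq_zero_iff _ hinj (x := eval (w y) f),
      ← hmapL, ← hmapL]
    have hc : c ≠ 0 := by
      rintro rfl
      refine hw0 x (funext fun i => hinj ?_)
      simpa using congrFun hxy i
    rw [hxy, aeval_smul_of_isHomogeneous hf, mul_eq_zero, or_iff_right (pow_ne_zero _ hc)]
  · intro y hy hyF
    have hmem : projectivePoint L y hy ∈ commonZeros L F := by
      rintro _ ⟨j, rfl⟩
      refine (mem_projectivePoint_iff hy ((hF j).map _)).mpr ?_
      rw [htower, ← hmap, hyF]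
    obtain ⟨m, hm⟩ := Function.ne_iff.mp (hw0 ⟨_, hmem⟩)
    refine ⟨⟨_, hmem⟩, y m / algebraMap L M (w ⟨_, hmem⟩ m), funext fun j => ?_⟩
    -- This linear form vanishes at the representative `w`, hence at `y`: the coordinates of the two
    -- are proportional.
    have hlin : (C (w ⟨_, hmem⟩ m) * X j - C (w ⟨_, hmem⟩ j) * X m :
        MvPolynomial (Fin (n + 1)) L).IsHomogeneous 1 :=
      (isHomogeneous_C_mul_X _ _).sub (isHomogeneous_C_mul_X _ _)
    have := (mem_projectivePoint_iff hy hlin).mp ((hw ⟨_, hmem⟩ 1 _ hlin).mpr (by simp [mul_comm]))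
    have hm' : algebraMap L M (w ⟨_, hmem⟩ m) ≠ 0 := (map_ne_zero_iff _ hinj).mpr hm
    simp only [map_sub, map_mul, aeval_C, aeval_X, sub_eq_zero] at this
    simp only [Pi.smul_apply, Function.comp_apply, smul_eq_mul]
    field_simp
    linear_combination this

end Points

/-! ### Order of the initial Fitting ideal -/

section Fitting

variable {R M : Type*} [CommRing R] [AddCommGroup M] [Module R M]

/-- With `m = B e` and `e = C m`, column operations turn `diag(A, 1)` bordered by `-C` into `[A, AB;
-C, 1 - CB]` without changing the determinant. The rows of the last `n` columns are relations of
`e`, so each term of the determinant has `n` factors in `Q`. -/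
theorem initialFittingIdeal_le_pow {n : ℕ} {e : Fin n → M}
    (he : Submodule.span R (Set.range e) = ⊤) {Q : Ideal R}
    (hQ : ∀ s : Fin n → R, ∑ j, s j • e j = 0 → ∀ j, s j ∈ Q) :
    initialFittingIdeal R M ≤ Q ^ n := by
  classical
  rw [initialFittingIdeal, Ideal.span_le]
  rintro _ ⟨k, m, A, hm, hA, rfl⟩
  have hspan : ∀ {l : ℕ} {w : Fin l → M}, Submodule.span R (Set.range w) = ⊤ →
      ∀ x, ∃ c : Fin l → R, ∑ i, c i • w i = x := fun hw x =>
    (Submodule.mem_span_range_iff_exists_fun R).mp (hw ▸ Submodule.mem_top)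
  choose B hB using fun i => hspan he (m i)
  choose C hC using fun j => hspan hm (e j)
  set N : Matrix (Fin k ⊕ Fin n) (Fin k ⊕ Fin n) R :=
    Matrix.fromBlocks A 0 (-Matrix.of C) 1 * Matrix.fromBlocks 1 (Matrix.of B) 0 1 with hN
  have hdet : A.det = N.det := by
    rw [hN, Matrix.det_mul, Matrix.det_fromBlocks_zero₁₂, Matrix.det_fromBlocks_zero₂₁]
    simp
  have hmem : ∀ i j, N i (Sum.inr j) ∈ Q := by
    intro i
    refine hQ _ ?_
    have hcomb : ∀ c : Fin k → R, ∑ j, (∑ l, c l * B l j) • e j = ∑ l, c l • m l := by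
      intro c
      simp_rw [Finset.sum_smul, mul_smul, ← hB, Finset.smul_sum]
      exact Finset.sum_comm
    rcases i with i | i
    · simp only [hN, Matrix.fromBlocks_multiply, Matrix.fromBlocks_apply₁₂, Matrix.add_apply,
        Matrix.mul_apply, Matrix.of_apply, Matrix.zero_apply, zero_mul, Finset.sum_const_zero,
        add_zero]
      rw [hcomb, hA]
    · simp only [hN, Matrix.fromBlocks_multiply, Matrix.fromBlocks_apply₂₂, Matrix.add_apply,
        Matrix.mul_apply, Matrix.of_apply, Matrix.neg_apply, mul_one, Matrix.one_mul, add_smul,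
        Finset.sum_add_distrib]
      rw [hcomb fun l => -C i l]
      simp [hC, Matrix.one_apply]
  rw [SetLike.mem_coe, hdet, Matrix.det_apply]
  refine Submodule.sum_mem _ fun σ _ => ?_
  rw [Units.smul_def, zsmul_eq_mul, Fintype.prod_sum_type]
  refine Ideal.mul_mem_left _ _ (Ideal.mul_mem_left _ _ ?_)
  have := Ideal.prod_mem_prod (s := Finset.univ) (I := fun _ : Fin n => Q) fun j _ =>
    hmem (σ (Sum.inr j)) j
  simpa using this

end Fitting

/-! ### Points of `𝕏` and its Hilbert function -/

namespace ZeroDimSubscheme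

variable {K : Type u} [Field K] {n : ℕ} (𝕏 : ZeroDimSubscheme K n)

section Points

variable {𝕏} {M : Type*} [Field M] [Algebra K M]

theorem apply_zero_ne_zero {z : Fin (n + 1) → M} (hz : z ≠ 0)
    (hzI : ∀ g ∈ 𝕏.ideal, aeval z g = 0) : z 0 ≠ 0 := by
  intro h0
  have hmem : projectivePoint K z hz ∈ (∅ : Set (ProjectiveSpectrum _)) := by
    rw [← 𝕏.support_inter]
    refine ⟨fun g hg => ?_, ?_⟩
    · have := Ideal.homogeneousCore_mono (homogeneousSubmodule (Fin (n + 1)) K)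
        (show 𝕏.ideal ≤ RingHom.ker (aeval (R := K) z) from hzI)
      refine this ?_
      rw [← HomogeneousIdeal.mem_iff, 𝕏.isHomogeneous.toIdeal_homogeneousCore_eq_self]
      exact hg
    · rintro _ rfl
      exact (mem_projectivePoint_iff hz (isHomogeneous_X K 0)).mpr (by simpa using h0)
  exact hmem

theorem exists_zero_of_notMem (hred : 𝕏.Reduced) (M : Type*) [Field M] [Algebra K M]
    [IsAlgClosed M] {f : MvPolynomial (Fin (n + 1)) K} (hf : f ∉ 𝕏.ideal) :
    ∃ z : Fin (n + 1) → M, z 0 ≠ 0 ∧ (∀ g ∈ 𝕏.ideal, aeval z g = 0) ∧ aeval z f ≠ 0 := by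
  -- Saturation supplies the factor `X i`, which keeps the zero found by the Nullstellensatz away
  -- from the origin.
  obtain ⟨i, hi⟩ : ∃ i, X i * f ∉ 𝕏.ideal := by
    by_contra! h
    exact hf (𝕏.saturated f h)
  have hrad : 𝕏.ideal.radical = 𝕏.ideal := Ideal.IsRadical.radical hred
  rw [← hrad, ← vanishingIdeal_zeroLocus_eq_radical (K := M)] at hi
  simp only [mem_vanishingIdeal_iff, mem_zeroLocus_iff, not_forall] at hi
  obtain ⟨z, hz, hzf⟩ := hi
  rw [map_mul, aeval_X, mul_eq_zero, not_or] at hzf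
  exact ⟨z, apply_zero_ne_zero (fun h => hzf.1 (by simp [h])) hz, hz, hzf.2⟩

theorem mem_of_X_zero_pow_mul_mem (hred : 𝕏.Reduced) {f : MvPolynomial (Fin (n + 1)) K} {e : ℕ}
    (hf : X 0 ^ e * f ∈ 𝕏.ideal) : f ∈ 𝕏.ideal := by
  by_contra h
  obtain ⟨z, hz0, hzI, hzf⟩ := exists_zero_of_notMem hred (AlgebraicClosure K) h
  have := hzI _ hf
  simp [hz0, hzf] at this

/-- Rescaling a zero of `I_𝕏` to have `z 0 = 1` gives a point of the affine scheme. Thus `R_d`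
embeds into `R / (x₀ - 1)`. -/
theorem mem_of_mem_sup_span (hred : 𝕏.Reduced) {f : MvPolynomial (Fin (n + 1)) K} {d : ℕ}
    (hf : f.IsHomogeneous d) (hfS : f ∈ 𝕏.ideal ⊔ Ideal.span {X 0 - 1}) : f ∈ 𝕏.ideal := by
  by_contra h
  obtain ⟨z, hz0, hzI, hzf⟩ := exists_zero_of_notMem hred (AlgebraicClosure K) h
  have hle : 𝕏.ideal ⊔ Ideal.span {X 0 - 1} ≤
      RingHom.ker (aeval (R := K) ((z 0)⁻¹ • z)) := by
    refine sup_le (fun g hg => ?_) ?_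
    · rw [RingHom.mem_ker, ← sum_homogeneousComponent g, map_sum]
      refine Finset.sum_eq_zero fun j _ => ?_
      rw [aeval_smul_of_isHomogeneous (homogeneousComponent_isHomogeneous _ _),
        hzI _ (homogeneousComponent_mem_of_mem 𝕏.isHomogeneous hg j), mul_zero]
    · rw [Ideal.span_singleton_le_iff_mem, RingHom.mem_ker]
      simp [hz0]
  have := hle hfS
  rw [RingHom.mem_ker, aeval_smul_of_isHomogeneous hf] at this
  simp [hz0, hzf] at this

end Points

section HilbertFunction

instance finite_gradedPart (d : ℕ) : Module.Finite K (𝕏.gradedPart d) := by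
  have := finite_homogeneousSubmodule K (Fin (n + 1)) d
  exact Module.Finite.map _ _

theorem hilbertFunction_natCast (J : Ideal 𝕏.coordRing) (d : ℕ) :
    𝕏.hilbertFunction J d = Module.finrank K ↥(J.restrictScalars K ⊓ 𝕏.gradedPart d) := by
  simp [hilbertFunction]

theorem HF_natCast (d : ℕ) : 𝕏.HF d = Module.finrank K (𝕏.gradedPart d) := by
  rw [HF, hilbertFunction_natCast, Submodule.restrictScalars_top, top_inf_eq]

theorem hilbertFunction_natCast_eq_zero_iff (J : Ideal 𝕏.coordRing) (d : ℕ) :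
    𝕏.hilbertFunction J d = 0 ↔ ∀ f : MvPolynomial (Fin (n + 1)) K, f.IsHomogeneous d →
      Ideal.Quotient.mk 𝕏.ideal f ∈ J → f ∈ 𝕏.ideal := by
  have : Module.Finite K ↥(J.restrictScalars K ⊓ 𝕏.gradedPart d) :=
    Submodule.finiteDimensional_of_le inf_le_right
  rw [hilbertFunction_natCast, Submodule.finrank_eq_zero, Submodule.eq_bot_iff]
  constructor
  · intro h f hf hfJ
    exact Ideal.Quotient.eq_zero_iff_mem.mp (h _ ⟨hfJ, f, hf, rfl⟩)
  · rintro h _ ⟨hJ, f, hf, rfl⟩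
    exact Ideal.Quotient.eq_zero_iff_mem.mpr (h f hf hJ)

theorem HF_add_finrank_idealPart (d : ℕ) :
    𝕏.HF d + Module.finrank K (𝕏.idealPart d) = (n + d).choose n := by
  have := finite_homogeneousSubmodule K (Fin (n + 1)) d
  rw [HF_natCast, ← finrank_homogeneousSubmodule (K := K) (σ := Fin (n + 1)) (by simp) d]
  set g := (Ideal.Quotient.mkₐ K 𝕏.ideal).toLinearMap.domRestrict
    (homogeneousSubmodule (Fin (n + 1)) K d) with hg
  rw [← g.finrank_range_add_finrank_ker, hg, LinearMap.range_domRestrict, LinearMap.ker_domRestrict]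
  congr 1
  rw [← Submodule.finrank_map_subtype_eq, Submodule.map_comap_subtype, idealPart, inf_comm,
    show 𝕏.ideal.restrictScalars K = LinearMap.ker (Ideal.Quotient.mkₐ K 𝕏.ideal).toLinearMap by
      ext f
      simp [Ideal.Quotient.eq_zero_iff_mem]]

theorem HF_eq_choose_iff (d : ℕ) : 𝕏.HF d = (n + d).choose n ↔ 𝕏.idealPart d = ⊥ := by
  have := finite_homogeneousSubmodule K (Fin (n + 1)) d
  have : Module.Finite K (𝕏.idealPart d) := Submodule.finiteDimensional_of_le inf_le_right
  rw [← 𝕏.HF_add_finrank_idealPart, left_eq_add, Submodule.finrank_eq_zero]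

variable {𝕏}

theorem idealPart_zero_eq_bot (hdeg : 0 < 𝕏.deg) : 𝕏.idealPart 0 = ⊥ := by
  rw [Submodule.eq_bot_iff]
  rintro f ⟨hfI, hf⟩
  by_contra hf0
  rw [homogeneousSubmodule_zero] at hf
  obtain ⟨c, rfl⟩ := Submodule.mem_one.mp hf
  have htop : 𝕏.ideal = ⊤ := Ideal.eq_top_of_isUnit_mem _ hfI
    ((isUnit_iff_ne_zero.mpr fun hc => hf0 (by rw [hc, map_zero])).map _)
  have : Subsingleton (MvPolynomial (Fin (n + 1)) K ⧸ (𝕏.ideal ⊔ Ideal.span {X 0 - 1})) :=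
    Ideal.Quotient.subsingleton_iff.mpr (by rw [htop, top_sup_eq])
  exact hdeg.ne' Module.finrank_zero_of_subsingleton

theorem HF_mono (hred : 𝕏.Reduced) {d e : ℕ} (hde : d ≤ e) : 𝕏.HF d ≤ 𝕏.HF e := by
  rw [HF_natCast, HF_natCast]
  have hmap : ∀ x ∈ 𝕏.gradedPart d,
      LinearMap.mulLeft K (𝕏.x₀ ^ (e - d)) x ∈ 𝕏.gradedPart e := by
    rintro _ ⟨f, hf, rfl⟩
    have := (isHomogeneous_X_pow (R := K) (0 : Fin (n + 1)) (e - d)).mul hf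
    rw [Nat.sub_add_cancel hde] at this
    exact ⟨_, this, by simp [x₀]⟩
  refine LinearMap.finrank_le_finrank_of_injective
    (f := (LinearMap.mulLeft K (𝕏.x₀ ^ (e - d))).restrict hmap) ?_
  rw [← LinearMap.ker_eq_bot, LinearMap.ker_eq_bot']
  rintro ⟨_, f, hf, rfl⟩ h
  have h' := congrArg Subtype.val h
  refine Subtype.ext (Ideal.Quotient.eq_zero_iff_mem.mpr
    (mem_of_X_zero_pow_mul_mem hred (e := e - d) (Ideal.Quotient.eq_zero_iff_mem.mp ?_)))
  simpa [x₀] using h'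

theorem HF_le_deg (hred : 𝕏.Reduced) (hdeg : 0 < 𝕏.deg) (d : ℕ) : 𝕏.HF d ≤ 𝕏.deg := by
  have : Module.Finite K (MvPolynomial (Fin (n + 1)) K ⧸ (𝕏.ideal ⊔ Ideal.span {X 0 - 1})) :=
    Module.finite_of_finrank_pos hdeg
  rw [HF_natCast]
  refine LinearMap.finrank_le_finrank_of_injective
    (f := (Ideal.Quotient.factorₐ K (le_sup_left : 𝕏.ideal ≤ 𝕏.ideal ⊔
      Ideal.span {X 0 - 1})).toLinearMap.domRestrict (𝕏.gradedPart d)) ?_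
  rw [← LinearMap.ker_eq_bot, LinearMap.ker_eq_bot']
  rintro ⟨_, f, hf, rfl⟩ h
  exact Subtype.ext (Ideal.Quotient.eq_zero_iff_mem.mpr
    (mem_of_mem_sup_span hred hf (Ideal.Quotient.eq_zero_iff_mem.mp h)))

/-- Below `α` the minimum is the binomial coefficient, attained exactly when `I_𝕏` has no forms
there; from `α` on, `HF` is squeezed between `HF α` and `deg`. -/
theorem inGenericPosition_iff (hred : 𝕏.Reduced) {α : ℕ} (hα : 0 < α)
    (hlower : (n + (α - 1)).choose n < 𝕏.deg) (hupper : 𝕏.deg < (n + α).choose n)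
    (hHF : 𝕏.HF α = 𝕏.deg) : 𝕏.InGenericPosition ↔ ∀ d < α, 𝕏.idealPart d = ⊥ := by
  have hmono : ∀ {d e : ℕ}, d ≤ e → (n + d).choose n ≤ (n + e).choose n := fun h =>
    Nat.choose_le_choose n (by omega)
  constructor
  · intro h d hd
    rw [← HF_eq_choose_iff, h d, if_pos (by positivity), Int.toNat_natCast]
    have := hmono (show d ≤ α - 1 by omega)
    omega
  · intro h i
    by_cases hi : 0 ≤ i
    · lift i to ℕ using hi
      rw [if_pos (by positivity), Int.toNat_natCast]
      by_cases hiα : i < α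
      · rw [(𝕏.HF_eq_choose_iff i).mpr (h i hiα)]
        have := hmono (show i ≤ α - 1 by omega)
        omega
      · have h1 := HF_mono hred (show α ≤ i by omega)
        have h2 := HF_le_deg hred (by omega) i
        have := hmono (show α ≤ i by omega)
        omega
    · simp [HF, hilbertFunction, hi]

end HilbertFunction

end ZeroDimSubscheme

/-! ### Determinants with a replaced row -/

section Determinants

/-- By Cramer's rule these determinants are the coefficients of `det J • c` in the rows of `J`. -/
theorem Matrix.exists_det_updateRow_ne_zero {k ι : Type*} [Field k] [Fintype ι]
    [DecidableEq ι] {J : Matrix ι ι k} (hJ : J.det ≠ 0) {c : ι → k} (hc : c ≠ 0) :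
    ∃ i, (J.updateRow i c).det ≠ 0 := by
  by_contra! h
  have := Matrix.mulVec_cramer J.transpose c
  rw [show J.transpose.cramer c = 0 from funext fun i => by
    rw [Matrix.cramer_transpose_apply, h i, Pi.zero_apply], Matrix.mulVec_zero,
    Matrix.det_transpose] at this
  exact (smul_ne_zero hJ hc) this.symm

theorem MvPolynomial.isHomogeneous_det {R σ ι : Type*} [CommRing R] [Fintype ι]
    [DecidableEq ι] {A : Matrix ι ι (MvPolynomial σ R)} {d : ι → ℕ}
    (hA : ∀ i j, (A i j).IsHomogeneous (d i)) : A.det.IsHomogeneous (∑ i, d i) := by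
  rw [Matrix.det_apply]
  refine IsHomogeneous.sum _ _ _ fun τ _ => ?_
  have := IsHomogeneous.prod Finset.univ (fun i => A (τ i) i) (fun i => d (τ i)) fun i _ => hA _ _
  rw [Equiv.sum_comp τ d] at this
  rcases Int.units_eq_one_or (Equiv.Perm.sign τ) with h | h
  · simpa [h] using this
  · simpa [h] using this.neg

end Determinants

/-! ### Differentials over `K[x₀]` and their relations -/

section Kaehler

variable {K : Type u} [Field K] {n : ℕ} {R : Type*} [CommRing R] [Algebra K R]
  (π : MvPolynomial (Fin (n + 1)) K →ₐ[K] R)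

/-- The differentials of the coordinate functions `x₁, …, xₙ` of a `K[x₀]`-algebra `R` that is
generated by `x₁, …, xₙ`. -/
def coordDifferential (j : Fin n) : KaehlerDifferential (Algebra.adjoin K {π (X 0)}) R :=
  KaehlerDifferential.D (Algebra.adjoin K {π (X 0)}) R (π (X j.succ))

theorem D_eq_sum_pderiv (f : MvPolynomial (Fin (n + 1)) K) :
    KaehlerDifferential.D (Algebra.adjoin K {π (X 0)}) R (π f) =
      ∑ j : Fin n, π (pderiv j.succ f) • coordDifferential π j := by
  have hbase : ∀ r ∈ Algebra.adjoin K {π (X 0)},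
      KaehlerDifferential.D (Algebra.adjoin K {π (X 0)}) R r = 0 :=
    fun r hr => (KaehlerDifferential.D (Algebra.adjoin K {π (X 0)}) R).map_algebraMap ⟨r, hr⟩
  induction f using MvPolynomial.induction_on with
  | C a =>
    rw [← algebraMap_eq, AlgHom.commutes, hbase _ (Subalgebra.algebraMap_mem _ a)]
    simp
  | add f g hf hg =>
    rw [map_add, map_add, hf, hg, ← Finset.sum_add_distrib]
    simp only [map_add, add_smul]
  | mul_X f i hf =>
    rw [map_mul, Derivation.leibniz, hf]
    simp only [Derivation.leibniz, map_add, smul_eq_mul, map_mul, add_smul, mul_smul,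
      Finset.sum_add_distrib, ← Finset.smul_sum]
    congr 2
    refine Fin.cases ?_ (fun j => ?_) i
    · rw [hbase _ (Algebra.subset_adjoin rfl)]
      simp [pderiv_X_of_ne (Fin.succ_ne_zero _).symm]
    · classical
      simp [pderiv_X, Pi.single_apply, apply_ite π, ite_smul, coordDifferential]

theorem span_range_coordDifferential (hπ : Function.Surjective π) :
    Submodule.span R (Set.range (coordDifferential π)) = ⊤ := by
  rw [eq_top_iff, ← KaehlerDifferential.span_range_derivation, Submodule.span_le]
  rintro _ ⟨r, rfl⟩
  obtain ⟨f, rfl⟩ := hπ r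
  rw [SetLike.mem_coe, D_eq_sum_pderiv]
  exact Submodule.sum_mem _ fun j _ =>
    Submodule.smul_mem _ _ (Submodule.subset_span ⟨j, rfl⟩)

theorem det_jacobian_mem_initialFittingIdeal (hπ : Function.Surjective π)
    {g : Fin n → MvPolynomial (Fin (n + 1)) K} (hg : ∀ i, π (g i) = 0) :
    π (Matrix.of fun i j : Fin n => pderiv j.succ (g i)).det ∈
      initialFittingIdeal R (KaehlerDifferential (Algebra.adjoin K {π (X 0)}) R) := by
  refine Ideal.subset_span ⟨n, coordDifferential π,
    π.mapMatrix (Matrix.of fun i j : Fin n => pderiv j.succ (g i)),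
    span_range_coordDifferential π hπ, fun i => ?_, AlgHom.map_det _ _⟩
  have := D_eq_sum_pderiv π (g i)
  rw [hg i, map_zero] at this
  exact this.symm

/-- `∂ᵢ` descends to `R → R ⧸ Q` because `Q` absorbs the partial derivatives of the kernel, and it
is `K[x₀]`-linear because `i.succ ≠ 0`. Its lift to differentials reads off the `i`-th coefficient
of a relation modulo `Q`. -/
theorem exists_derivation_quotient (hπ : Function.Surjective π) (Q : Ideal R) (i : Fin n)
    (hQ : ∀ f, π f = 0 → π (pderiv i.succ f) ∈ Q) :
    ∃ δ : Derivation (Algebra.adjoin K {π (X 0)}) R (R ⧸ Q), ∀ f,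
      δ (π f) = Ideal.Quotient.mk Q (π (pderiv i.succ f)) := by
  have hwell : ∀ f g, π f = π g →
      Ideal.Quotient.mk Q (π (pderiv i.succ f)) = Ideal.Quotient.mk Q (π (pderiv i.succ g)) := by
    intro f g h
    rw [Ideal.Quotient.eq, ← map_sub, ← map_sub]
    exact hQ _ (by rw [map_sub, h, sub_self])
  obtain ⟨T, hT⟩ : ∃ T : R → R ⧸ Q, ∀ f, T (π f) = Ideal.Quotient.mk Q (π (pderiv i.succ f)) :=
    ⟨fun r => Ideal.Quotient.mk Q (π (pderiv i.succ (Function.surjInv hπ r))), fun f =>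
      hwell _ _ (Function.surjInv_eq hπ _)⟩
  have hadd : ∀ r s, T (r + s) = T r + T s := by
    intro r s
    obtain ⟨f, rfl⟩ := hπ r
    obtain ⟨g, rfl⟩ := hπ s
    rw [← map_add, hT, hT, hT, map_add, map_add, map_add]
  have hmul : ∀ r s, T (r * s) = r • T s + s • T r := by
    intro r s
    obtain ⟨f, rfl⟩ := hπ r
    obtain ⟨g, rfl⟩ := hπ s
    rw [← map_mul, hT, hT, hT, Derivation.leibniz]
    simp [Algebra.smul_def]
  have hbase : ∀ r ∈ Algebra.adjoin K {π (X 0)}, T r = 0 := by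
    intro r hr
    induction hr using Algebra.adjoin_induction with
    | mem x hx =>
      rw [Set.mem_singleton_iff.mp hx, hT, pderiv_X_of_ne (Fin.succ_ne_zero i).symm]
      simp
    | algebraMap a =>
      rw [← AlgHom.commutes π, hT, algebraMap_eq, pderiv_C]
      simp
    | add x y _ _ hx hy => rw [hadd, hx, hy, add_zero]
    | mul x y _ _ hx hy => rw [hmul, hx, hy, smul_zero, smul_zero, add_zero]
  refine ⟨Derivation.mk' ⟨⟨T, hadd⟩, fun r s => ?_⟩ hmul, hT⟩
  change T (r • s) = r • T s
  rw [Algebra.smul_def, hmul]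
  change (r : R) • T s + s • T (r : R) = _
  rw [hbase _ r.2, smul_zero, add_zero]
  rfl

theorem mem_of_sum_smul_coordDifferential_eq_zero (hπ : Function.Surjective π) (Q : Ideal R)
    (hQ : ∀ f, π f = 0 → ∀ i : Fin n, π (pderiv i.succ f) ∈ Q)
    {s : Fin n → R} (hs : ∑ j, s j • coordDifferential π j = 0) (i : Fin n) : s i ∈ Q := by
  classical
  obtain ⟨δ, hδ⟩ := exists_derivation_quotient π hπ Q i fun f hf => hQ f hf i
  have := congrArg δ.liftKaehlerDifferential hs
  rw [map_sum, map_zero] at this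
  simp only [map_smul, coordDifferential, Derivation.liftKaehlerDifferential_comp_D, hδ, pderiv_X,
    Pi.single_apply, Fin.succ_inj] at this
  rw [Finset.sum_eq_single i (fun j _ hj => by simp [hj]) (by simp)] at this
  rw [← Ideal.Quotient.eq_zero_iff_mem]
  simpa [Algebra.smul_def] using this

end Kaehler

/-! ### The Kähler different in degree `n(α - 1) - 1` -/

namespace ZeroDimSubscheme

variable {K : Type u} [Field K] {n : ℕ} (𝕏 : ZeroDimSubscheme K n)

section KaehlerDifferent

theorem det_jacobian_mem_kaehlerDifferent {g : Fin n → MvPolynomial (Fin (n + 1)) K}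
    (hg : ∀ i, g i ∈ 𝕏.ideal) :
    Ideal.Quotient.mk 𝕏.ideal (Matrix.of fun i j : Fin n => pderiv j.succ (g i)).det ∈
      𝕏.kaehlerDifferent :=
  det_jacobian_mem_initialFittingIdeal (Ideal.Quotient.mkₐ K 𝕏.ideal)
    (Ideal.Quotient.mkₐ_surjective K _) fun i => Ideal.Quotient.eq_zero_iff_mem.mpr (hg i)

theorem pderiv_mem_pow_idealOfVars {α : ℕ} (h : ∀ d < α, 𝕏.idealPart d = ⊥)
    {f : MvPolynomial (Fin (n + 1)) K} (hf : f ∈ 𝕏.ideal) (i : Fin (n + 1)) :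
    pderiv i f ∈ idealOfVars (Fin (n + 1)) K ^ (α - 1) := by
  rw [← sum_homogeneousComponent f, map_sum]
  refine Submodule.sum_mem _ fun d _ => ?_
  have hhom := homogeneousComponent_isHomogeneous d f
  by_cases hd : d < α
  · have : homogeneousComponent d f ∈ 𝕏.idealPart d :=
      ⟨homogeneousComponent_mem_of_mem 𝕏.isHomogeneous hf d, hhom⟩
    rw [h d hd, Submodule.mem_bot] at this
    rw [this, map_zero]
    exact zero_mem _
  · exact hhom.pderiv.mem_pow_idealOfVars (by omega)

theorem kaehlerDifferent_le {α : ℕ} (h : ∀ d < α, 𝕏.idealPart d = ⊥) :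
    𝕏.kaehlerDifferent ≤
      (idealOfVars (Fin (n + 1)) K ^ ((α - 1) * n)).map (Ideal.Quotient.mk 𝕏.ideal) := by
  rw [pow_mul, Ideal.map_pow]
  have hπ := Ideal.Quotient.mkₐ_surjective K 𝕏.ideal
  exact initialFittingIdeal_le_pow (span_range_coordDifferential _ hπ) fun s hs =>
    mem_of_sum_smul_coordDifferential_eq_zero _ hπ _ (fun f hf i =>
      Ideal.mem_map_of_mem _ (𝕏.pderiv_mem_pow_idealOfVars h
        (Ideal.Quotient.eq_zero_iff_mem.mp hf) i.succ)) hs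

theorem mem_ideal_of_mk_mem_map_pow_idealOfVars {d e : ℕ} (hde : d < e)
    {f : MvPolynomial (Fin (n + 1)) K} (hf : f.IsHomogeneous d)
    (hfe : Ideal.Quotient.mk 𝕏.ideal f ∈
      (idealOfVars (Fin (n + 1)) K ^ e).map (Ideal.Quotient.mk 𝕏.ideal)) : f ∈ 𝕏.ideal := by
  obtain ⟨h, hh, hfh⟩ := (Ideal.mem_map_iff_of_surjective _ Ideal.Quotient.mk_surjective).mp hfe
  have hsub := homogeneousComponent_mem_of_mem 𝕏.isHomogeneous (Ideal.Quotient.eq.mp hfh.symm) d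
  have hh0 : homogeneousComponent d h = 0 := by
    ext x
    rw [coeff_homogeneousComponent, coeff_zero]
    split_ifs with hx
    · exact (mem_pow_idealOfVars_iff' e h).mp hh x (by omega)
    · rfl
  rwa [map_sub, hh0, sub_zero, homogeneousComponent_eq_self hf] at hsub

theorem hilbertFunction_kaehlerDifferent_eq_zero {α : ℕ} (h : ∀ d < α, 𝕏.idealPart d = ⊥) {e : ℕ}
    (he : e < (α - 1) * n) : 𝕏.hilbertFunction 𝕏.kaehlerDifferent e = 0 :=
  (𝕏.hilbertFunction_natCast_eq_zero_iff _ e).mpr fun _ hf hfJ =>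
    𝕏.mem_ideal_of_mk_mem_map_pow_idealOfVars he hf (𝕏.kaehlerDifferent_le h hfJ)

end KaehlerDifferent

section Jacobian

/-- Otherwise all partial derivatives vanish by minimality of the degree, and Euler's formula gives
`d * g = 0`. -/
theorem exists_pderiv_notMem {d : ℕ} (hdK : (d : K) ≠ 0)
    (hmin : 𝕏.idealPart (d - 1) = ⊥) {g : MvPolynomial (Fin (n + 1)) K} (hg0 : g ≠ 0)
    (hg : g.IsHomogeneous d) : ∃ m, pderiv m g ∉ 𝕏.ideal := by
  by_contra! h
  have hzero : ∀ m, pderiv m g = 0 := fun m => by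
    have : pderiv m g ∈ 𝕏.idealPart (d - 1) := ⟨h m, hg.pderiv⟩
    rwa [hmin, Submodule.mem_bot] at this
  have := hg.sum_X_mul_pderiv
  simp only [hzero, mul_zero, Finset.sum_const_zero, nsmul_eq_mul] at this
  rw [← map_natCast (C : K →+* MvPolynomial (Fin (n + 1)) K), eq_comm, mul_eq_zero, C_eq_zero] at this
  exact this.elim hdK hg0

/-- A form of minimal degree `d` of `I_𝕏` gives rise to a non-zero element of the Kähler
different in degree `n (α - 1) - 1`. -/
theorem hilbertFunction_kaehlerDifferent_ne_zero (hred : 𝕏.Reduced) {α : ℕ} {L : Type v} [Field L]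
    [Algebra K L] {F : Fin n → MvPolynomial (Fin (n + 1)) K} (hF : ∀ j, F j ∈ 𝕏.idealPart α)
    (hmeet : MeetInRationalPoints L F (α ^ n)) {d : ℕ} (hdα : d < α) (hα : 1 < α)
    (hdK : (d : K) ≠ 0) (hmin : 𝕏.idealPart (d - 1) = ⊥) (hd : 𝕏.idealPart d ≠ ⊥) {e : ℕ}
    (he : e + 1 = n * (α - 1)) : 𝕏.hilbertFunction 𝕏.kaehlerDifferent e ≠ 0 := by
  classical
  obtain ⟨g, ⟨hgI, hg⟩, hg0⟩ := Submodule.exists_mem_ne_zero_of_ne_bot hd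
  obtain ⟨m, hm⟩ := 𝕏.exists_pderiv_notMem hdK hmin hg0 hg
  obtain ⟨z, hz0, hzI, hzm⟩ := exists_zero_of_notMem hred (AlgebraicClosure L) hm
  replace hgI : g ∈ 𝕏.ideal := hgI
  replace hg : g.IsHomogeneous d := hg
  -- Padding to degree `α - 1` makes the new row have degree exactly one less than the others.
  set h := X 0 ^ (α - 1 - d) * g with hh
  have hhI : h ∈ 𝕏.ideal := Ideal.mul_mem_left _ _ hgI
  have hhhom : h.IsHomogeneous (α - 1) := by
    have := (isHomogeneous_X_pow (R := K) (0 : Fin (n + 1)) (α - 1 - d)).mul hg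
    rwa [Nat.sub_add_cancel (by omega)] at this
  have hJ := det_jacobian_ne_zero_of_meetInRationalPoints (M := AlgebraicClosure L) (by omega)
    (fun j => (hF j).2) hmeet hz0 fun j => hzI _ (hF j).1
  have hgrad : (fun j : Fin n => aeval z (pderiv j.succ h)) ≠ 0 := by
    intro hzero
    have hz' : ∀ j : Fin n, aeval z (pderiv j.succ g) = 0 := fun j => by
      have := congrFun hzero j
      simpa [hh, Derivation.leibniz, Derivation.leibniz_pow, pderiv_X_of_ne (Fin.succ_ne_zero _).symm,
        hzI g hgI, hz0] using this
    -- The Jacobian omits `∂₀`, but Euler's formula at the zero `z` with `z 0 ≠ 0` recovers it from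
    -- the other partial derivatives.
    have h0 : aeval z (pderiv 0 g) = 0 := by
      have := congrArg (aeval z) hg.sum_X_mul_pderiv
      rw [Fin.sum_univ_succ] at this
      simpa [hz', hzI g hgI, hz0] using this
    exact hzm (Fin.cases h0 hz' m)
  obtain ⟨i, hi⟩ := Matrix.exists_det_updateRow_ne_zero hJ hgrad
  set A := Matrix.of fun i' j : Fin n => pderiv j.succ (Function.update F i h i') with hA
  rw [Ne, hilbertFunction_natCast_eq_zero_iff]
  intro hcontra
  have hmem : A.det ∈ 𝕏.ideal := by
    refine hcontra _ ?_ (𝕏.det_jacobian_mem_kaehlerDifferent fun i' => ?_)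
    · have := isHomogeneous_det (A := A) (d := Function.update (fun _ => α - 1) i (α - 1 - 1))
        fun i' j => by
          by_cases hi' : i' = i
          · subst hi'
            simpa [hA] using hhhom.pderiv
          · simpa [hA, hi'] using IsHomogeneous.pderiv (hF i').2
      have hsum : ∑ i', Function.update (fun _ => α - 1) i (α - 1 - 1) i' = e := by
        rw [Finset.sum_update_of_mem (Finset.mem_univ _), Finset.sum_const, smul_eq_mul,
          Finset.card_sdiff]
        obtain ⟨n', rfl⟩ : ∃ n', n = n' + 1 := ⟨n - 1, by have := i.2; omega⟩
        simp
        rw [add_mul] at he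
        omega
      rwa [hsum] at this
    · by_cases hi' : i' = i
      · subst hi'
        simpa using hhI
      · simpa [hi'] using (hF i').1
  refine hi ?_
  rw [← hzI _ hmem, AlgHom.map_det]
  congr 1
  ext i' j
  by_cases hi' : i' = i
  · subst hi'
    simp [hA]
  · simp [hA, hi']

end Jacobian

end ZeroDimSubscheme

theorem Nat.lt_choose_add_left {n b : ℕ} (hn : 0 < n) : b < (n + b).choose n := by
  rw [Nat.choose_symm_add]
  calc b < (b + 1).choose b := by simp
    _ ≤ _ := Nat.choose_le_choose b (by omega)

end

theorem proposition3p10 {K : Type u} [Field K] {n : ℕ} (𝕏 : ZeroDimSubscheme K n)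
    (hchar : ringChar K = 0 ∨ 𝕏.deg < ringChar K)
    (hred : 𝕏.Reduced)
    (α : ℕ) (hα : 1 < α)
    (hdeg_lower : (n + (α - 1)).choose n < 𝕏.deg)
    (hdeg_upper : 𝕏.deg < (n + α).choose n)
    (h_i : 𝕏.HF α = 𝕏.deg)
    (h_ii : n ≤ Module.finrank K (𝕏.idealPart α))
    (L : Type v) [Field L] [Algebra K L]
    (h_iii : ∃ F : Fin n → MvPolynomial (Fin (n + 1)) K,
      (∀ j, F j ∈ 𝕏.idealPart α) ∧ LinearIndependent K F ∧ MeetInRationalPoints L F (α ^ n)) :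
    𝕏.InGenericPosition ↔
      𝕏.hilbertFunction 𝕏.kaehlerDifferent ((n : ℤ) * α - n - 1) = 0 := by
  -- For `n = 0` both binomial coefficients are `1`, leaving no room for `deg`.
  have hn : 0 < n := by
    rcases Nat.eq_zero_or_pos n with rfl | hn
    · simp at hdeg_lower hdeg_upper
      omega
    · exact hn
  obtain ⟨F, hF, -, hmeet⟩ := h_iii
  obtain ⟨e, he⟩ : ∃ e, e + 1 = n * (α - 1) :=
    ⟨n * (α - 1) - 1, Nat.sub_add_cancel (Nat.mul_pos hn (by omega))⟩
  have hcast : (n : ℤ) * α - n - 1 = e := by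
    have := congrArg (Nat.cast : ℕ → ℤ) he
    push_cast [Nat.cast_sub hα.le] at this
    linarith
  rw [hcast, ZeroDimSubscheme.inGenericPosition_iff hred (by omega) hdeg_lower hdeg_upper h_i]
  refine ⟨fun h => 𝕏.hilbertFunction_kaehlerDifferent_eq_zero h (by rw [mul_comm]; omega), ?_⟩
  contrapose!
  rintro ⟨d₀, hd₀⟩
  classical
  have hex : ∃ d, 𝕏.idealPart d ≠ ⊥ := ⟨d₀, hd₀.2⟩
  have hdα : Nat.find hex < α := (Nat.find_min' hex hd₀.2).trans_lt hd₀.1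
  have hd0 : Nat.find hex ≠ 0 := fun h0 => by
    have h1 := Nat.find_spec hex
    rw [h0] at h1
    exact h1 (ZeroDimSubscheme.idealPart_zero_eq_bot (by omega))
  refine 𝕏.hilbertFunction_kaehlerDifferent_ne_zero hred hF hmeet hdα hα ?_ ?_
    (Nat.find_spec hex) he
  -- If `char K` is positive, then `d ≤ α - 1 < binom(n + α - 1, n) < deg < char K`, so `d ≠ 0` in
  -- `K`.
  · intro hdK
    rcases hchar with h0 | hlt
    · rw [ringChar.spec, h0, zero_dvd_iff] at hdK
      exact hd0 hdK
    · have := Nat.le_of_dvd (Nat.pos_of_ne_zero hd0) ((ringChar.spec K _).mp hdK)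
      have := Nat.lt_choose_add_left (b := α - 1) hn
      omega
  · exact not_not.mp (Nat.find_min hex (Nat.sub_lt (Nat.pos_of_ne_zero hd0) one_pos))
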